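/- A dyadic interval is an interval $[n2^{j},(n+1)2^{j})$ with $j,n\in\mathbb Z$, a dyadic rectangle is a product $R=I\times J$ of two dyadic intervals, and $|R|$ is its area. For $p,q\in[0,1)^2$ put $$\operatorname{dist}_{\mathbb H}(p,q)=\inf\{|R|^{1/2}: R \text{ is a dyadic rectangle containing } p \text{ and } q\}.$$ **Theorem.** There are absolute constants $c,C>0$ and $C_0\in\mathbb N$ such that the following holds for all integers $k\ge 1$ and $m\ge k+C_0$. Let $\mathcal P\subset[0,1)^2$ be a $2^{-m}$-separated set of maximal size, that is, $\operatorname{dist}_{\mathbb H}(p,q)\ge 2^{-m}$ for all $p\ne q$ in $\mathcal P$ and $\#\mathcal P=2^{2m+1}$. Then there is a finite set $\mathcal Z\subset[0,1)^2$ such that: 1. $c\,m2^{2m}\le \#\mathcal Z\le C\,m2^{2m}$. 2. For every $z\in\mathcal Z$ there is exactly one point $p(z)\in\mathcal P$ with $\operatorname{dist}_{\mathbb H}(p(z),z)^2<2^{-2m-1}$. 3. For every $z\in\mathcal Z$, $c\,2^{-2m-k}\le\operatorname{dist}_{\mathbb H}(p(z),z)^2\le C\,2^{-2m-k}$. 4.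 For every dyadic rectangle $R$ with $|R|\le 2^{-2m-2}$ that intersects $\mathcal P$, $\#(R\cap\mathcal Z)\le Ck$. 5. For every dyadic rectangle $R$ with $|R|\ge 2^{-2m-1}$, $\#(R\cap\mathcal Z)\le C\,2^{2m}mk|R|$. -/

import Mathlib

open Set MeasureTheory

/-- The unit square `[0,1)²`. -/
def unitSquare : Set (ℝ × ℝ) := Ico (0 : ℝ) 1 ×ˢ Ico (0 : ℝ) 1

/-- Dyadic intervals of the line: `[n 2^j, (n+1) 2^j)` with `j, n ∈ ℤ`. -/
def IsDyadicInterval (I : Set ℝ) : Prop :=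
  ∃ j n : ℤ, I = Ico ((n : ℝ) * (2 : ℝ) ^ j) (((n : ℝ) + 1) * (2 : ℝ) ^ j)

/-- Dyadic rectangles: products of two dyadic intervals, of arbitrary eccentricity. -/
def IsDyadicRectangle (R : Set (ℝ × ℝ)) : Prop :=
  ∃ I J : Set ℝ, IsDyadicInterval I ∧ IsDyadicInterval J ∧ R = I ×ˢ J

/-- The biparameter dyadic "distance": the infimum of `|R|^{1/2}` over the dyadic rectangles `R`
containing both points. It is used for points of `[0,1)²`, which is itself a dyadic rectangle,
so there the infimum is over a nonempty set of nonnegative reals. -/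
noncomputable def distH (p q : ℝ × ℝ) : ℝ :=
  sInf {d : ℝ | ∃ R : Set (ℝ × ℝ), IsDyadicRectangle R ∧ p ∈ R ∧ q ∈ R ∧
    d = Real.sqrt (volume.real R)}

/-- A set of points is `ε`-separated with respect to `distH`. -/
def IsSeparatedH (ε : ℝ) (P : Set (ℝ × ℝ)) : Prop :=
  ∀ p ∈ P, ∀ q ∈ P, p ≠ q → ε ≤ distH p q

/-! Put N = 2m+1. By pigeonhole P is a net: every dyadic cell of area 2^-N in the square holds
exactly one point of P. To each p in P and each shape i in [k, N] attach a satellite z sharing with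
p exactly i binary digits in x and N+k-i in y. Its later digits are chosen greedily: a cell of area
2^-N holds one net point, and the next digit sends z to the half without it. So the cells of area
2^(-N-1) around z miss P, except for k intermediate shapes, which contain p and no other net point
(`IsSatellite.eq_of_sameCell`). This controls the distances, and a small rectangle through p admits
at most k values of i.

For large rectangles, a cell has only two halves, so two points of one cell that both avoid its net
point lie in the same half. Closeness thus propagates back to shape i
(`IsDyadicNet.sameCell_of_avoiding`): for fixed i, a cell of area 2^-N meets satellites of a single
p (`IsSatellite.center_unique`), hence at most N+1-k points of Z. -/

/-! ### Binary digits -/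

/-- Two reals lie in the same dyadic interval of length `2⁻ʲ`. -/
def AgreeTo (j : ℕ) (x y : ℝ) : Prop := ⌊x * 2 ^ j⌋ = ⌊y * 2 ^ j⌋

namespace AgreeTo

variable {j l : ℕ} {x y w : ℝ}

theorem refl (j : ℕ) (x : ℝ) : AgreeTo j x x := rfl

theorem symm (h : AgreeTo j x y) : AgreeTo j y x := Eq.symm h

theorem trans (h : AgreeTo j x y) (h' : AgreeTo j y w) : AgreeTo j x w := Eq.trans h h'

theorem floor_succ (j : ℕ) (x : ℝ) :
    ⌊x * 2 ^ (j + 1)⌋ = 2 * ⌊x * 2 ^ j⌋ ∨ ⌊x * 2 ^ (j + 1)⌋ = 2 * ⌊x * 2 ^ j⌋ + 1 := by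
  have h1 := Int.floor_le (x * 2 ^ j)
  have h2 := Int.lt_floor_add_one (x * 2 ^ j)
  have e : x * 2 ^ (j + 1) = 2 * (x * 2 ^ j) := by ring
  have l1 : 2 * ⌊x * 2 ^ j⌋ ≤ ⌊x * 2 ^ (j + 1)⌋ := by
    rw [Int.le_floor, e]; push_cast; linarith
  have l2 : ⌊x * 2 ^ (j + 1)⌋ < 2 * ⌊x * 2 ^ j⌋ + 2 := by
    rw [Int.floor_lt, e]; push_cast; linarith
  omega

theorem of_succ (h : AgreeTo (j + 1) x y) : AgreeTo j x y := by
  unfold AgreeTo at *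
  have := floor_succ j x
  have := floor_succ j y
  omega

theorem mono (h : AgreeTo l x y) (hjl : j ≤ l) : AgreeTo j x y := by
  induction l, hjl using Nat.le_induction with
  | base => exact h
  | succ n _ ih => exact ih h.of_succ

/-- A binary digit has two values, so two digits that differ from a third coincide. -/
theorem succ_of_not (hx : AgreeTo j x w) (hy : AgreeTo j y w)
    (hx' : ¬ AgreeTo (j + 1) x w) (hy' : ¬ AgreeTo (j + 1) y w) : AgreeTo (j + 1) x y := by
  unfold AgreeTo at *
  have := floor_succ j x
  have := floor_succ j y
  have := floor_succ j w
  omega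

theorem zero (hx : x ∈ Ico (0 : ℝ) 1) (hy : y ∈ Ico (0 : ℝ) 1) : AgreeTo 0 x y := by
  unfold AgreeTo
  rw [pow_zero, mul_one, mul_one, Int.floor_eq_zero_iff.2 hx, Int.floor_eq_zero_iff.2 hy]

theorem exists_not_succ (j : ℕ) (hx : x ∈ Ico (0 : ℝ) 1) (w : ℝ) :
    ∃ y ∈ Ico (0 : ℝ) 1, AgreeTo j y x ∧ ¬ AgreeTo (j + 1) y w := by
  obtain ⟨d, hd, hdw⟩ : ∃ d : ℤ, (d = 2 * ⌊x * 2 ^ j⌋ ∨ d = 2 * ⌊x * 2 ^ j⌋ + 1) ∧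
      d ≠ ⌊w * 2 ^ (j + 1)⌋ := by
    by_cases h : 2 * ⌊x * 2 ^ j⌋ = ⌊w * 2 ^ (j + 1)⌋
    · exact ⟨_, Or.inr rfl, by omega⟩
    · exact ⟨_, Or.inl rfl, h⟩
  have hp : (0 : ℝ) < 2 ^ (j + 1) := by positivity
  have hf : ⌊(d : ℝ) / 2 ^ (j + 1) * 2 ^ (j + 1)⌋ = d := by
    rw [div_mul_cancel₀ _ hp.ne', Int.floor_intCast]
  have h0 : 0 ≤ ⌊x * 2 ^ j⌋ := Int.floor_nonneg.2 (mul_nonneg hx.1 (by positivity))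
  have h1 : ⌊x * 2 ^ j⌋ < 2 ^ j := by
    rw [Int.floor_lt]; push_cast
    nlinarith [hx.2, show (0 : ℝ) < 2 ^ j by positivity]
  have hd0 : 0 ≤ d := by omega
  have hd1 : d < 2 ^ (j + 1) := by rw [pow_succ]; omega
  refine ⟨d / 2 ^ (j + 1), ⟨by positivity, ?_⟩, ?_, ?_⟩
  · rw [div_lt_one hp]; exact_mod_cast hd1
  · have := floor_succ j ((d : ℝ) / 2 ^ (j + 1))
    unfold AgreeTo
    omega
  · unfold AgreeTo
    rw [hf]; exact hdw

end AgreeTo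

/-! ### Dyadic rectangles and the distance in terms of digits -/

/-- Membership in the dyadic interval `[n 2ʲ, (n+1) 2ʲ)`, rescaled by `2ᶜ`. -/
theorem mul_pow_mem_Ico_of_mem_dyadic {j n : ℤ} {x : ℝ} (c : ℕ)
    (hx : x ∈ Ico ((n : ℝ) * (2 : ℝ) ^ j) (((n : ℝ) + 1) * (2 : ℝ) ^ j)) :
    x * 2 ^ c ∈ Ico ((n : ℝ) * (2 : ℝ) ^ (c + j)) (((n : ℝ) + 1) * (2 : ℝ) ^ (c + j)) := by
  have hp : (0 : ℝ) < 2 ^ c := by positivity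
  rw [zpow_add₀ two_ne_zero, zpow_natCast]
  constructor <;> nlinarith [hx.1, hx.2]

theorem agreeTo_of_mem_dyadic {j n : ℤ} {x y : ℝ}
    (hx : x ∈ Ico ((n : ℝ) * (2 : ℝ) ^ j) (((n : ℝ) + 1) * (2 : ℝ) ^ j))
    (hy : y ∈ Ico ((n : ℝ) * (2 : ℝ) ^ j) (((n : ℝ) + 1) * (2 : ℝ) ^ j))
    (hx1 : x ∈ Ico (0 : ℝ) 1) (hy1 : y ∈ Ico (0 : ℝ) 1) : AgreeTo (-j).toNat x y := by
  rcases le_or_gt 0 j with hj | hj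
  · rw [Int.toNat_of_nonpos (by omega)]
    exact AgreeTo.zero hx1 hy1
  · have key : ∀ w ∈ Ico ((n : ℝ) * (2 : ℝ) ^ j) (((n : ℝ) + 1) * (2 : ℝ) ^ j),
        ⌊w * 2 ^ (-j).toNat⌋ = n := by
      intro w hw
      have := mul_pow_mem_Ico_of_mem_dyadic (-j).toNat hw
      rw [Int.toNat_of_nonneg (by omega), neg_add_cancel, zpow_zero, mul_one, mul_one] at this
      rwa [Int.floor_eq_iff]
    unfold AgreeTo
    rw [key x hx, key y hy]

theorem mem_dyadic_floor (a : ℕ) (x : ℝ) :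
    x ∈ Ico ((⌊x * 2 ^ a⌋ : ℝ) * (2 : ℝ) ^ (-(a : ℤ)))
      (((⌊x * 2 ^ a⌋ : ℝ) + 1) * (2 : ℝ) ^ (-(a : ℤ))) := by
  have hp : (0 : ℝ) < 2 ^ a := by positivity
  rw [zpow_neg, zpow_natCast, ← div_eq_mul_inv, ← div_eq_mul_inv]
  refine ⟨?_, ?_⟩
  · rw [div_le_iff₀ hp]; exact Int.floor_le _
  · rw [lt_div_iff₀ hp]; exact Int.lt_floor_add_one _

theorem volume_real_dyadic_prod (j n j' n' : ℤ) :
    volume.real (Ico ((n : ℝ) * (2 : ℝ) ^ j) (((n : ℝ) + 1) * (2 : ℝ) ^ j) ×ˢ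
      Ico ((n' : ℝ) * (2 : ℝ) ^ j') (((n' : ℝ) + 1) * (2 : ℝ) ^ j')) = 2 ^ (j + j') := by
  have h : ∀ j n : ℤ, volume.real (Ico ((n : ℝ) * (2 : ℝ) ^ j) (((n : ℝ) + 1) * (2 : ℝ) ^ j))
      = 2 ^ j := by
    intro j n
    have hp : (0 : ℝ) < 2 ^ j := by positivity
    rw [Real.volume_real_Ico_of_le (by nlinarith)]
    ring
  rw [Measure.volume_eq_prod, measureReal_prod_prod, h, h, zpow_add₀ two_ne_zero]

/-- Two points lie in the same dyadic rectangle of sides `2⁻ᵃ` and `2⁻ᵇ`. -/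
def SameCell (a b : ℕ) (z w : ℝ × ℝ) : Prop := AgreeTo a z.1 w.1 ∧ AgreeTo b z.2 w.2

namespace SameCell

variable {a b a' b' : ℕ} {z w v : ℝ × ℝ}

theorem symm (h : SameCell a b z w) : SameCell a b w z := ⟨h.1.symm, h.2.symm⟩

theorem trans (h : SameCell a b z w) (h' : SameCell a b w v) : SameCell a b z v :=
  ⟨h.1.trans h'.1, h.2.trans h'.2⟩

theorem mono (h : SameCell a b z w) (ha : a' ≤ a) (hb : b' ≤ b) : SameCell a' b' z w :=
  ⟨h.1.mono ha, h.2.mono hb⟩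

end SameCell

/-- Sides longer than 1 are truncated to zero digits, which costs nothing inside the unit square. -/
theorem exists_sameCell_of_mem_rectangle {R : Set (ℝ × ℝ)} (hR : IsDyadicRectangle R) {n : ℤ}
    (hv : volume.real R ≤ 2 ^ (-n)) :
    ∃ a b : ℕ, n ≤ a + b ∧ ∀ z ∈ R, ∀ w ∈ R, z ∈ unitSquare → w ∈ unitSquare →
      SameCell a b z w := by
  obtain ⟨I, J, ⟨j, s, rfl⟩, ⟨j', s', rfl⟩, rfl⟩ := hR
  rw [volume_real_dyadic_prod, zpow_le_zpow_iff_right₀ one_lt_two] at hv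
  refine ⟨(-j).toNat, (-j').toNat, by omega, fun z hz w hw hz1 hw1 => ?_⟩
  exact ⟨agreeTo_of_mem_dyadic hz.1 hw.1 hz1.1 hw1.1, agreeTo_of_mem_dyadic hz.2 hw.2 hz1.2 hw1.2⟩

theorem distH_nonneg (p q : ℝ × ℝ) : 0 ≤ distH p q := by
  apply Real.sInf_nonneg
  rintro d ⟨R, -, -, -, rfl⟩
  exact Real.sqrt_nonneg _

/-- Areas are powers of two, so a strict bound gains one digit; surplus digits can be dropped to
reach equality. -/
theorem distH_sq_lt_iff {p q : ℝ × ℝ} (hp : p ∈ unitSquare) (hq : q ∈ unitSquare) (n : ℕ) :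
    distH p q ^ 2 < 2 ^ (-(n : ℤ)) ↔ ∃ a b : ℕ, a + b = n + 1 ∧ SameCell a b p q := by
  have hpos : (0 : ℝ) < 2 ^ (-(n : ℤ)) := by positivity
  rw [← Real.lt_sqrt (distH_nonneg p q)]
  have hmem : ∀ a b : ℕ, SameCell a b p q → Real.sqrt (2 ^ (-(a : ℤ) + -(b : ℤ))) ∈
      {d : ℝ | ∃ R : Set (ℝ × ℝ), IsDyadicRectangle R ∧ p ∈ R ∧ q ∈ R ∧
        d = Real.sqrt (volume.real R)} := by
    intro a b h
    refine ⟨_, ⟨_, _, ⟨-(a : ℤ), ⌊p.1 * 2 ^ a⌋, rfl⟩, ⟨-(b : ℤ), ⌊p.2 * 2 ^ b⌋, rfl⟩, rfl⟩,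
      ⟨mem_dyadic_floor a p.1, mem_dyadic_floor b p.2⟩, ⟨?_, ?_⟩, ?_⟩
    · have := h.1
      unfold AgreeTo at this
      rw [this]
      exact mem_dyadic_floor a q.1
    · have := h.2
      unfold AgreeTo at this
      rw [this]
      exact mem_dyadic_floor b q.2
    · rw [volume_real_dyadic_prod]
  unfold distH
  rw [csInf_lt_iff]
  · constructor
    · rintro ⟨d, ⟨R, hR, hpR, hqR, rfl⟩, hd⟩
      rw [Real.sqrt_lt_sqrt_iff measureReal_nonneg] at hd
      have hv : volume.real R ≤ 2 ^ (-((n : ℤ) + 1)) := by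
        obtain ⟨I, J, ⟨j, s, rfl⟩, ⟨j', s', rfl⟩, rfl⟩ := hR
        rw [volume_real_dyadic_prod] at hd ⊢
        rw [zpow_lt_zpow_iff_right₀ one_lt_two] at hd
        rw [zpow_le_zpow_iff_right₀ one_lt_two]
        omega
      obtain ⟨a, b, hab, h⟩ := exists_sameCell_of_mem_rectangle hR hv
      refine ⟨min a (n + 1), n + 1 - min a (n + 1), by omega,
        (h p hpR q hqR hp hq).mono (by omega) (by omega)⟩
    · rintro ⟨a, b, hab, h⟩
      refine ⟨_, hmem a b h, ?_⟩
      rw [Real.sqrt_lt_sqrt_iff (by positivity), zpow_lt_zpow_iff_right₀ one_lt_two]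
      omega
  · exact ⟨0, by rintro d ⟨R, -, -, -, rfl⟩; exact Real.sqrt_nonneg _⟩
  · exact ⟨_, hmem 0 0 ⟨AgreeTo.zero hp.1 hq.1, AgreeTo.zero hp.2 hq.2⟩⟩

/-! ### Dyadic nets and greedy avoidance -/

/-- A dyadic net in the unit square: each dyadic rectangle of area `2⁻ᴺ` in the unit square
contains exactly one point. -/
structure IsDyadicNet (N : ℕ) (P : Set (ℝ × ℝ)) : Prop where
  subset : P ⊆ unitSquare
  exists_sameCell : ∀ a b : ℕ, a + b = N → ∀ z ∈ unitSquare, ∃ p ∈ P, SameCell a b z p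
  eq_of_sameCell : ∀ a b : ℕ, a + b = N → ∀ p ∈ P, ∀ q ∈ P, SameCell a b p q → p = q

theorem floor_mul_pow_mem_Ico {x : ℝ} (hx : x ∈ Ico (0 : ℝ) 1) (a : ℕ) :
    ⌊x * 2 ^ a⌋ ∈ Finset.Ico (0 : ℤ) (2 ^ a) := by
  have hp : (0 : ℝ) < 2 ^ a := by positivity
  rw [Finset.mem_Ico]
  refine ⟨Int.floor_nonneg.2 (mul_nonneg hx.1 hp.le), ?_⟩
  rw [Int.floor_lt]; push_cast
  nlinarith [hx.2]

/-- Pigeonhole: separation puts at most one point in each cell, and each shape has as many cells as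
P has points. -/
theorem isDyadicNet_of_separated {m : ℕ} {P : Set (ℝ × ℝ)} (hPU : P ⊆ unitSquare)
    (hsep : IsSeparatedH ((2 : ℝ) ^ (-(m : ℤ))) P) (hcard : P.ncard = 2 ^ (2 * m + 1)) :
    IsDyadicNet (2 * m + 1) P := by
  have heq : ∀ a b : ℕ, a + b = 2 * m + 1 → ∀ p ∈ P, ∀ q ∈ P, SameCell a b p q → p = q := by
    intro a b hab p hp q hq h
    by_contra hne
    have h1 := hsep p hp q hq hne
    have h2 := (distH_sq_lt_iff (hPU hp) (hPU hq) (2 * m)).2 ⟨a, b, hab, h⟩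
    have h3 : ((2 : ℝ) ^ (-(m : ℤ))) ^ 2 = 2 ^ (-((2 * m : ℕ) : ℤ)) := by
      rw [← zpow_natCast, ← zpow_mul]; congr 1; push_cast; ring
    rw [← h3] at h2
    exact absurd (pow_le_pow_left₀ (by positivity) h1 2) (not_le.2 h2)
  refine ⟨hPU, fun a b hab z hz => ?_, heq⟩
  let g : ℝ × ℝ → ℤ × ℤ := fun w => (⌊w.1 * 2 ^ a⌋, ⌊w.2 * 2 ^ b⌋)
  let T : Finset (ℤ × ℤ) := Finset.Ico (0 : ℤ) (2 ^ a) ×ˢ Finset.Ico (0 : ℤ) (2 ^ b)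
  have hg : ∀ w ∈ unitSquare, g w ∈ (T : Set (ℤ × ℤ)) := fun w hw => by
    rw [Finset.mem_coe, Finset.mem_product]
    exact ⟨floor_mul_pow_mem_Ico hw.1 a, floor_mul_pow_mem_Ico hw.2 b⟩
  have hT : (T : Set (ℤ × ℤ)).ncard = 2 ^ (2 * m + 1) := by
    rw [Set.ncard_coe_finset, Finset.card_product, Int.card_Ico, Int.card_Ico, ← hab, pow_add, sub_zero, sub_zero]
    norm_cast
  have hinj : InjOn g P := fun p hp q hq h =>
    heq a b hab p hp q hq ⟨congrArg Prod.fst h, congrArg Prod.snd h⟩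
  have himg : g '' P = T := by
    apply Set.eq_of_subset_of_ncard_le
    · rintro _ ⟨p, hp, rfl⟩; exact hg p (hPU hp)
    · rw [hinj.ncard_image, hT, hcard]
    · exact T.finite_toSet
  obtain ⟨p, hp, h⟩ : g z ∈ g '' P := himg ▸ hg z hz
  exact ⟨p, hp, (congrArg Prod.fst h).symm, (congrArg Prod.snd h).symm⟩

namespace IsDyadicNet

variable {N : ℕ} {P : Set (ℝ × ℝ)}

theorem swap (hP : IsDyadicNet N P) : IsDyadicNet N (Prod.swap ⁻¹' P) where
  subset := fun z hz => ⟨(hP.subset hz).2, (hP.subset hz).1⟩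
  exists_sameCell := fun a b hab z hz => by
    obtain ⟨p, hp, h⟩ := hP.exists_sameCell b a (by omega) z.swap ⟨hz.2, hz.1⟩
    exact ⟨p.swap, by simpa using hp, h.2, h.1⟩
  eq_of_sameCell := fun a b hab p hp q hq h => Prod.swap_injective <|
    hP.eq_of_sameCell b a (by omega) _ hp _ hq ⟨h.2, h.1⟩

/-- The binary digits of the first coordinate after the `i`-th can be chosen so that the small
dyadic rectangles at all wider shapes miss the net. -/
theorem exists_fst_avoiding (hP : IsDyadicNet N P) {p : ℝ × ℝ} (hp : p ∈ unitSquare) (i : ℕ) :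
    ∃ x ∈ Ico (0 : ℝ) 1, AgreeTo i x p.1 ∧
      ∀ j, i ≤ j → j ≤ N → ∀ q ∈ P, ¬ SameCell (j + 1) (N - j) (x, p.2) q := by
  suffices H : ∀ d, i + d ≤ N + 1 → ∃ x ∈ Ico (0 : ℝ) 1, AgreeTo i x p.1 ∧
      ∀ j, i ≤ j → j < i + d → ∀ q ∈ P, ¬ SameCell (j + 1) (N - j) (x, p.2) q by
    rcases le_or_gt i (N + 1) with hi | hi
    · obtain ⟨x, hx, h1, h2⟩ := H (N + 1 - i) (by omega)
      exact ⟨x, hx, h1, fun j hj hjN => h2 j hj (by omega)⟩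
    · exact ⟨p.1, hp.1, AgreeTo.refl _ _, fun j hj hjN => by omega⟩
  intro d
  induction d with
  | zero => exact fun _ => ⟨p.1, hp.1, AgreeTo.refl _ _, fun j hj hjN => by omega⟩
  | succ d ih =>
    intro hd
    obtain ⟨x, hx, h1, h2⟩ := ih (by omega)
    -- The next digit is chosen to differ from that of `q`, the only net point of the current cell;
    -- earlier cells do not read this digit.
    obtain ⟨q, hq, hxq⟩ := hP.exists_sameCell (i + d) (N - (i + d)) (by omega) (x, p.2) ⟨hx, hp.2⟩
    obtain ⟨x', hx', h3, h4⟩ := AgreeTo.exists_not_succ (i + d) hx q.1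
    refine ⟨x', hx', (h3.mono (by omega)).trans h1, fun j hj hjd r hr hc => ?_⟩
    rcases Nat.lt_or_ge j (i + d) with hlt | hge
    · exact h2 j hj hlt r hr ⟨(h3.mono (by omega)).symm.trans hc.1, hc.2⟩
    · obtain rfl : j = i + d := by omega
      have hxr : SameCell (i + d) (N - (i + d)) (x, p.2) r := ⟨h3.symm.trans hc.1.of_succ, hc.2⟩
      have : q = r := hP.eq_of_sameCell _ _ (by omega) q hq r hr (hxq.symm.trans hxr)
      exact h4 (this ▸ hc.1)

/-- If the dyadic rectangles of area `2⁻ᴺ⁻¹` of shape between `i` and `a` around `z` and `w` miss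
the net, then `z` and `w` are in the same cell of shape `i` as soon as they are in the same cell of
shape `a`. -/
theorem sameCell_of_avoiding (hP : IsDyadicNet N P) {z w : ℝ × ℝ} (hz : z ∈ unitSquare)
    {i a : ℕ} (hia : i ≤ a) (haN : a ≤ N)
    (hz' : ∀ j, i ≤ j → j ≤ N → ∀ q ∈ P, ¬ SameCell (j + 1) (N - j) z q)
    (hw' : ∀ j, i ≤ j → j ≤ N → ∀ q ∈ P, ¬ SameCell (j + 1) (N - j) w q)
    (h : SameCell a (N - a) z w) : SameCell i (N - i) z w := by
  induction a, hia using Nat.le_induction with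
  | base => exact h
  | succ j hij ih =>
    apply ih (by omega)
    obtain ⟨q, hq, hzq⟩ := hP.exists_sameCell (j + 1) (N - (j + 1)) (by omega) z hz
    have hwq := h.symm.trans hzq
    have e : N - j = N - (j + 1) + 1 := by omega
    refine ⟨h.1.of_succ, ?_⟩
    rw [e]
    -- Both points lie in the half of the common cell that does not contain `q`.
    refine hzq.2.succ_of_not hwq.2 (fun h' => ?_) (fun h' => ?_)
    · exact hz' j hij (by omega) q hq ⟨hzq.1, by rwa [e]⟩
    · exact hw' j hij (by omega) q hq ⟨hwq.1, by rwa [e]⟩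

end IsDyadicNet

/-! ### Satellites -/

/-- The point `z` is attached to the net point `p` at shape `i`: the smallest dyadic rectangle
containing `p` and `z` has sides `2⁻ⁱ` and `2^(i-N-k)`, and the dyadic rectangles of area `2⁻ᴺ⁻¹`
containing `z` whose shape prevents them from containing `p` miss the net. -/
structure IsSatellite (N k : ℕ) (P : Set (ℝ × ℝ)) (p : ℝ × ℝ) (i : ℕ) (z : ℝ × ℝ) : Prop where
  mem : z ∈ unitSquare
  sameCell : SameCell i (N + k - i) z p
  not_fst : ¬ AgreeTo (i + 1) z.1 p.1
  not_snd : ¬ AgreeTo (N + k - i + 1) z.2 p.2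
  avoid_fst : ∀ j, i ≤ j → j ≤ N → ∀ q ∈ P, ¬ SameCell (j + 1) (N - j) z q
  avoid_snd : ∀ j, j + k ≤ i → ∀ q ∈ P, ¬ SameCell j (N + 1 - j) z q

theorem IsDyadicNet.exists_isSatellite {N k : ℕ} {P : Set (ℝ × ℝ)} (hP : IsDyadicNet N P)
    {p : ℝ × ℝ} (hp : p ∈ P) {i : ℕ} (hki : k ≤ i) (hiN : i ≤ N) :
    ∃ z, IsSatellite N k P p i z := by
  have hpU := hP.subset hp
  obtain ⟨x, hx, hxi, hxa⟩ := hP.exists_fst_avoiding hpU i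
  obtain ⟨y, hy, hyi, hya⟩ := hP.swap.exists_fst_avoiding (p := p.swap) ⟨hpU.2, hpU.1⟩ (N + k - i)
  have hya' : ∀ j, j + k ≤ i → ∀ q ∈ P, ¬ SameCell j (N + 1 - j) (p.1, y) q := by
    intro j hj q hq hc
    refine hya (N - j) (by omega) (by omega) q.swap (by simpa using hq) ⟨?_, ?_⟩
    · rw [show N - j + 1 = N + 1 - j by omega]; exact hc.2
    · rw [show N - (N - j) = j by omega]; exact hc.1
  refine ⟨(x, y), ⟨hx, hy⟩, ⟨hxi, hyi⟩, fun h => ?_, fun h => ?_, fun j hj hjN q hq hc => ?_,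
    fun j hj q hq hc => ?_⟩
  · exact hxa i le_rfl hiN p hp ⟨h, AgreeTo.refl _ _⟩
  · refine hya' (i - k) (by omega) p hp ⟨AgreeTo.refl _ _, ?_⟩
    rw [show N + 1 - (i - k) = N + k - i + 1 by omega]; exact h
  -- Cells with j ≥ i read only digits of `y` shared with `p.2`, so the two coordinates can be
  -- chosen independently.
  · exact hxa j hj hjN q hq ⟨hc.1, (hyi.mono (by omega)).symm.trans hc.2⟩
  · exact hya' j hj q hq ⟨(hxi.mono (by omega)).symm.trans hc.1, hc.2⟩

namespace IsSatellite

variable {N k i : ℕ} {P : Set (ℝ × ℝ)} {p z : ℝ × ℝ}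

theorem le_of_sameCell (h : IsSatellite N k P p i z) {a b : ℕ} (hc : SameCell a b p z) :
    a ≤ i ∧ b ≤ N + k - i := by
  constructor
  · by_contra! hlt
    exact h.not_fst (hc.symm.1.mono hlt)
  · by_contra! hlt
    exact h.not_snd (hc.symm.2.mono hlt)

theorem index_unique {i' : ℕ} (h : IsSatellite N k P p i z) (h' : IsSatellite N k P p i' z) :
    i = i' :=
  le_antisymm (h'.le_of_sameCell h.sameCell.symm).1 (h.le_of_sameCell h'.sameCell.symm).1

theorem eq_of_sameCell (hP : IsDyadicNet N P) (hp : p ∈ P) (h : IsSatellite N k P p i z)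
    {a b : ℕ} (hab : a + b = N + 1) {q : ℝ × ℝ} (hq : q ∈ P) (hc : SameCell a b q z) : q = p := by
  rcases Nat.lt_or_ge i a with hia | hia
  · refine (h.avoid_fst (a - 1) (by omega) (by omega) q hq ?_).elim
    rw [show a - 1 + 1 = a by omega, show N - (a - 1) = b by omega]
    exact hc.symm
  rcases Nat.lt_or_ge i (a + k) with hik | hik
  -- Dropping one digit gives a cell of area 2^-N that also contains `p`; for a = 0 the digit must
  -- come from y.
  · rcases Nat.eq_zero_or_pos a with rfl | ha
    · exact hP.eq_of_sameCell 0 N (by omega) q hq p hp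
        ((hc.mono le_rfl (by omega)).trans (h.sameCell.mono (by omega) (by omega)))
    · exact hP.eq_of_sameCell (a - 1) b (by omega) q hq p hp
        ((hc.mono (by omega) le_rfl).trans (h.sameCell.mono (by omega) (by omega)))
  · refine (h.avoid_snd a hik q hq ?_).elim
    rw [show N + 1 - a = b by omega]
    exact hc.symm

/-- At a given shape `i`, a dyadic rectangle of area `2⁻ᴺ` contains satellites of at most one net
point. -/
theorem center_unique (hP : IsDyadicNet N P) (hki : k ≤ i) (hiN : i ≤ N) {p' z' : ℝ × ℝ}
    (hp : p ∈ P) (hp' : p' ∈ P) (h : IsSatellite N k P p i z) (h' : IsSatellite N k P p' i z')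
    {a : ℕ} (haN : a ≤ N) (hc : SameCell a (N - a) z z') : p = p' := by
  -- For i-k ≤ j ≤ i the cell of shape j around a satellite contains its center. A shape `a` outside
  -- this range is moved to the nearer endpoint.
  suffices H : ∃ j, j ≤ i ∧ i ≤ j + k ∧ SameCell j (N - j) z z' by
    obtain ⟨j, hji, hij, hj⟩ := H
    exact hP.eq_of_sameCell j (N - j) (by omega) p hp p' hp'
      (((h.sameCell.mono hji (by omega)).symm.trans hj).trans (h'.sameCell.mono hji (by omega)))
  rcases le_or_gt i a with hia | hia
  · exact ⟨i, le_rfl, by omega,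
      hP.sameCell_of_avoiding h.mem hia haN h.avoid_fst h'.avoid_fst hc⟩
  rcases le_or_gt i (a + k) with hik | hik
  · exact ⟨a, hia.le, hik, hc⟩
  · have av : ∀ {q w}, IsSatellite N k P q i w → ∀ j, N + k - i ≤ j → j ≤ N →
        ∀ r ∈ Prod.swap ⁻¹' P, ¬ SameCell (j + 1) (N - j) w.swap r := by
      intro q w hw j hj hjN r hr hc'
      refine hw.avoid_snd (N - j) (by omega) r.swap hr ⟨hc'.2, ?_⟩
      rw [show N + 1 - (N - j) = j + 1 by omega]
      exact hc'.1
    have := hP.swap.sameCell_of_avoiding (z := z.swap) (w := z'.swap) ⟨h.mem.2, h.mem.1⟩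
      (i := N + k - i) (a := N - a) (by omega) (by omega) (av h) (av h')
      ⟨hc.2, by rw [show N - (N - a) = a by omega]; exact hc.1⟩
    refine ⟨i - k, by omega, by omega, ?_, ?_⟩
    · have := this.2
      rwa [show N - (N + k - i) = i - k by omega] at this
    · have := this.1
      rwa [show N + k - i = N - (i - k) by omega] at this

end IsSatellite

/-! ### Counting and assembly -/

/-- A dyadic interval meets at most `max 1 2^(c+j)` dyadic subintervals of `[0,1)` of length
`2⁻ᶜ`. -/
theorem exists_finset_floor_mem (j n : ℤ) (c : ℕ) : ∃ S : Finset ℤ,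
    (∀ y ∈ Ico ((n : ℝ) * (2 : ℝ) ^ j) (((n : ℝ) + 1) * (2 : ℝ) ^ j), y ∈ Ico (0 : ℝ) 1 →
      ⌊y * 2 ^ c⌋ ∈ S) ∧ S.card ≤ 2 ^ (c + j).toNat := by
  rcases le_or_gt 0 (c + j) with hcj | hcj
  · refine ⟨Finset.Ico (n * 2 ^ (c + j).toNat) ((n + 1) * 2 ^ (c + j).toNat),
      fun y hy _ => ?_, ?_⟩
    · have := mul_pow_mem_Ico_of_mem_dyadic c hy
      rw [← Int.toNat_of_nonneg hcj, zpow_natCast] at this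
      rw [Finset.mem_Ico, Int.le_floor, Int.floor_lt]
      push_cast
      exact this
    · rw [Int.card_Ico, ← sub_mul, add_sub_cancel_left, one_mul]
      norm_cast
  · by_cases h : ∃ y₀ ∈ Ico ((n : ℝ) * (2 : ℝ) ^ j) (((n : ℝ) + 1) * (2 : ℝ) ^ j),
        y₀ ∈ Ico (0 : ℝ) 1
    · obtain ⟨y₀, hy₀, hy₀'⟩ := h
      refine ⟨{⌊y₀ * 2 ^ c⌋}, fun y hy hy' => ?_, by simpa using Nat.one_le_two_pow⟩
      rw [Finset.mem_singleton]
      exact (agreeTo_of_mem_dyadic hy hy₀ hy' hy₀').mono (by omega)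
    · exact ⟨∅, fun y hy hy' => (h ⟨y, hy, hy'⟩).elim, by simp⟩

/-- A dyadic rectangle of area at least `2⁻ᴺ` is covered, inside the unit square, by at most
`2ᴺ |R|` dyadic rectangles of area `2⁻ᴺ` of one shape. -/
theorem exists_shape_cover {N : ℕ} {R : Set (ℝ × ℝ)} (hR : IsDyadicRectangle R)
    (hv : (2 : ℝ) ^ (-(N : ℤ)) ≤ volume.real R) : ∃ a ≤ N, ∃ S : Finset ℤ,
      (∀ z ∈ R, z ∈ unitSquare → ⌊z.2 * 2 ^ (N - a)⌋ ∈ S) ∧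
      (∀ z ∈ R, ∀ w ∈ R, z ∈ unitSquare → w ∈ unitSquare → AgreeTo a z.1 w.1) ∧
      (S.card : ℝ) ≤ 2 ^ N * volume.real R := by
  obtain ⟨I, J, ⟨j, s, rfl⟩, ⟨j', s', rfl⟩, rfl⟩ := hR
  rw [volume_real_dyadic_prod] at hv ⊢
  rw [zpow_le_zpow_iff_right₀ one_lt_two] at hv
  have hvol : (2 : ℝ) ^ N * 2 ^ (j + j') = 2 ^ (N + j + j').toNat := by
    rw [← zpow_natCast, ← zpow_natCast, ← zpow_add₀ two_ne_zero, Int.toNat_of_nonneg (by omega)]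
    congr 1; ring
  rw [hvol]
  have hx : ∀ a ≤ (-j).toNat, ∀ z ∈ Ico ((s : ℝ) * (2 : ℝ) ^ j) (((s : ℝ) + 1) * (2 : ℝ) ^ j) ×ˢ
      Ico ((s' : ℝ) * (2 : ℝ) ^ j') (((s' : ℝ) + 1) * (2 : ℝ) ^ j'),
      ∀ w ∈ Ico ((s : ℝ) * (2 : ℝ) ^ j) (((s : ℝ) + 1) * (2 : ℝ) ^ j) ×ˢ
      Ico ((s' : ℝ) * (2 : ℝ) ^ j') (((s' : ℝ) + 1) * (2 : ℝ) ^ j'),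
      z ∈ unitSquare → w ∈ unitSquare → AgreeTo a z.1 w.1 := fun a ha z hz w hw hz1 hw1 =>
    (agreeTo_of_mem_dyadic hz.1 hw.1 hz1.1 hw1.1).mono ha
  rcases le_or_gt (-j).toNat N with hj | hj
  · obtain ⟨S, hS, hcard⟩ := exists_finset_floor_mem j' s' (N - (-j).toNat)
    refine ⟨(-j).toNat, hj, S, fun z hz hz1 => hS z.2 hz.2 hz1.2, hx _ le_rfl, ?_⟩
    have : S.card ≤ 2 ^ (N + j + j').toNat :=
      hcard.trans (Nat.pow_le_pow_right two_pos (by omega))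
    exact_mod_cast this
  -- A rectangle narrower than 2^-N fits in one column of full height, where no digit of y is read.
  · refine ⟨N, le_rfl, {0}, fun z hz hz1 => ?_, hx _ hj.le, ?_⟩
    · simpa using hz1.2
    · simpa using one_le_pow₀ (M₀ := ℝ) one_le_two

/-- The constructed set: satellites of all net points at all admissible shapes. -/
theorem IsDyadicNet.exists_satellite_set {N k : ℕ} {P : Set (ℝ × ℝ)} (hP : IsDyadicNet N P)
    (hk : 1 ≤ k) (hfin : P.Finite) :
    ∃ f : (ℝ × ℝ) × ℕ → ℝ × ℝ,
      (∀ t ∈ P ×ˢ Icc k N, IsSatellite N k P t.1 t.2 (f t)) ∧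
      (f '' (P ×ˢ Icc k N)).Finite ∧
      (f '' (P ×ˢ Icc k N)).ncard = P.ncard * (N + 1 - k) := by
  have H : ∀ t : (ℝ × ℝ) × ℕ, ∃ z, t ∈ P ×ˢ Icc k N → IsSatellite N k P t.1 t.2 z := by
    intro t
    by_cases ht : t ∈ P ×ˢ Icc k N
    · obtain ⟨z, hz⟩ := hP.exists_isSatellite ht.1 ht.2.1 ht.2.2
      exact ⟨z, fun _ => hz⟩
    · exact ⟨0, fun h => (ht h).elim⟩
  choose f hf using H
  have hinj : InjOn f (P ×ˢ Icc k N) := by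
    rintro ⟨p, i⟩ ht ⟨p', i'⟩ ht' he
    have h := hf _ ht
    have h' := hf _ ht'
    rw [← he] at h'
    have hi : i ≤ N := ht.2.2
    have hi' : i' ≤ N := ht'.2.2
    have hk' : k ≤ i' := ht'.2.1
    -- Since k ≥ 1, a satellite and its center share a cell of area 2^(-N-1), which determines the
    -- center.
    have hpp : p' = p := h.eq_of_sameCell hP ht.1 (a := i') (b := N + 1 - i') (by omega) ht'.1
      (h'.sameCell.symm.mono le_rfl (by simp only; omega))
    subst hpp
    exact Prod.ext rfl (h.index_unique h')
  refine ⟨f, hf, (hfin.prod (finite_Icc k N)).image f, ?_⟩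
  rw [hinj.ncard_image, Set.ncard_prod, Set.ncard_eq_toFinset_card' (Icc k N)]
  simp

theorem theorem2p2 :
    ∃ (c C : ℝ) (C₀ : ℕ), 0 < c ∧ 0 < C ∧
      ∀ k m : ℕ, 1 ≤ k → k + C₀ ≤ m →
      ∀ P : Set (ℝ × ℝ), P ⊆ unitSquare →
        IsSeparatedH ((2 : ℝ) ^ (-(m : ℤ))) P →
        P.ncard = 2 ^ (2 * m + 1) →
      ∃ Z : Set (ℝ × ℝ), Z ⊆ unitSquare ∧ Z.Finite ∧
        -- cardinality
        (c * ((m : ℝ) * (2 : ℝ) ^ (2 * m)) ≤ (Z.ncard : ℝ) ∧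
          (Z.ncard : ℝ) ≤ C * ((m : ℝ) * (2 : ℝ) ^ (2 * m))) ∧
        -- each point of `Z` is close to exactly one point of `P`
        (∀ z ∈ Z, ∃! p : ℝ × ℝ, p ∈ P ∧ distH p z ^ 2 < (2 : ℝ) ^ (-2 * (m : ℤ) - 1)) ∧
        -- the size of the distance to that point
        (∀ z ∈ Z, ∀ p ∈ P, distH p z ^ 2 < (2 : ℝ) ^ (-2 * (m : ℤ) - 1) →
          c * (2 : ℝ) ^ (-2 * (m : ℤ) - (k : ℤ)) ≤ distH p z ^ 2 ∧
          distH p z ^ 2 ≤ C * (2 : ℝ) ^ (-2 * (m : ℤ) - (k : ℤ))) ∧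
        -- small rectangles that meet `P`
        (∀ R : Set (ℝ × ℝ), IsDyadicRectangle R →
          volume.real R ≤ (2 : ℝ) ^ (-2 * (m : ℤ) - 2) → (R ∩ P).Nonempty →
          ((R ∩ Z).ncard : ℝ) ≤ C * (k : ℝ)) ∧
        -- large rectangles
        (∀ R : Set (ℝ × ℝ), IsDyadicRectangle R →
          (2 : ℝ) ^ (-2 * (m : ℤ) - 1) ≤ volume.real R →
          ((R ∩ Z).ncard : ℝ) ≤ C * ((2 : ℝ) ^ (2 * m) * (m : ℝ) * (k : ℝ) * volume.real R)) := by
  refine ⟨1 / 2, 8, 0, by norm_num, by norm_num, fun k m hk hkm P hPU hsep hcard => ?_⟩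
  have hP := isDyadicNet_of_separated hPU hsep hcard
  have hfin : P.Finite := Set.finite_of_ncard_ne_zero (by rw [hcard]; positivity)
  obtain ⟨f, hf, hZfin, hZcard⟩ := hP.exists_satellite_set hk hfin
  have hm1 : (1 : ℝ) ≤ m := by exact_mod_cast (show 1 ≤ m by omega)
  have hk1 : (1 : ℝ) ≤ k := by exact_mod_cast hk
  have hkm' : (k : ℝ) ≤ m := by exact_mod_cast (show k ≤ m by omega)
  have hpow : (0 : ℝ) < 2 ^ (2 * m) := by positivity
  have e1 : -2 * (m : ℤ) - 1 = -((2 * m + 1 : ℕ) : ℤ) := by push_cast; ring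
  have close : ∀ t ∈ P ×ˢ Icc k (2 * m + 1), ∀ q ∈ P,
      (distH q (f t) ^ 2 < (2 : ℝ) ^ (-2 * (m : ℤ) - 1) ↔ q = t.1) := by
    intro t ht q hq
    have h := hf t ht
    have hi : t.2 ≤ 2 * m + 1 := ht.2.2
    rw [e1, distH_sq_lt_iff (hPU hq) h.mem]
    constructor
    · rintro ⟨a, b, hab, hc⟩
      exact h.eq_of_sameCell hP ht.1 hab hq hc
    · rintro rfl
      exact ⟨t.2, 2 * m + 1 + 1 - t.2, by omega, h.sameCell.symm.mono le_rfl (by omega)⟩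
  refine ⟨f '' (P ×ˢ Icc k (2 * m + 1)), ?_, hZfin, ?_, ?_, ?_, ?_, ?_⟩
  · rintro _ ⟨t, ht, rfl⟩
    exact (hf t ht).mem
  · rw [hZcard, hcard]
    push_cast [Nat.cast_sub (show k ≤ 2 * m + 1 + 1 by omega)]
    rw [pow_succ]
    constructor <;> nlinarith
  · rintro _ ⟨t, ht, rfl⟩
    exact ⟨t.1, ⟨ht.1, (close t ht _ ht.1).2 rfl⟩, fun q hq => (close t ht q hq.1).1 hq.2⟩
  · rintro _ ⟨t, ht, rfl⟩ p hp hlt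
    obtain rfl := (close t ht p hp).1 hlt
    have h := hf t ht
    have hi : t.2 ≤ 2 * m + 1 := ht.2.2
    constructor
    -- The squared distance is exactly 2^(-2m-1-k), whence the constant 1/2.
    · have hlow : ¬ distH t.1 (f t) ^ 2 < 2 ^ (-((2 * m + 1 + k : ℕ) : ℤ)) := by
        rw [distH_sq_lt_iff (hPU hp) h.mem]
        rintro ⟨a, b, hab, hc⟩
        have := h.le_of_sameCell hc
        omega
      refine le_trans (le_of_eq ?_) (not_lt.1 hlow)
      rw [show -((2 * m + 1 + k : ℕ) : ℤ) = -2 * (m : ℤ) - (k : ℤ) - 1 by push_cast; ring,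
        zpow_sub_one₀ two_ne_zero]
      ring
    · have hup : distH t.1 (f t) ^ 2 < 2 ^ (-((2 * m + k : ℕ) : ℤ)) := by
        rw [distH_sq_lt_iff (hPU hp) h.mem]
        exact ⟨t.2, 2 * m + 1 + k - t.2, by omega, h.sameCell.symm⟩
      rw [show -((2 * m + k : ℕ) : ℤ) = -2 * (m : ℤ) - (k : ℤ) by push_cast; ring] at hup
      have : (0 : ℝ) < 2 ^ (-2 * (m : ℤ) - (k : ℤ)) := by positivity
      linarith
  · rintro R hR hv ⟨p, hpR, hp⟩
    rw [show -2 * (m : ℤ) - 2 = -(2 * (m : ℤ) + 2) by ring] at hv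
    obtain ⟨a, b, hab, hc⟩ := exists_sameCell_of_mem_rectangle hR hv
    -- Sharing the cell with `p` forces a ≤ i ≤ N+k-b, and a+b ≥ N+1 leaves at most k indices.
    have hsub : R ∩ f '' (P ×ˢ Icc k (2 * m + 1)) ⊆
        ((Finset.Ico a (2 * m + 2 + k - b)).image fun i => f (p, i) : Finset (ℝ × ℝ)) := by
      rintro _ ⟨hzR, ⟨q, i⟩, ht, rfl⟩
      have h := hf _ ht
      have hi : i ≤ 2 * m + 1 := ht.2.2
      have hcell := hc p hpR _ hzR (hPU hp) h.mem
      have hpq : p = q := h.eq_of_sameCell hP ht.1 (a := min a (2 * m + 2))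
        (b := 2 * m + 2 - min a (2 * m + 2)) (by omega) hp (hcell.mono (by omega) (by omega))
      subst hpq
      have := h.le_of_sameCell hcell
      simp only at this
      rw [Finset.mem_coe]
      exact Finset.mem_image_of_mem _ (Finset.mem_Ico.2 (by omega))
    have hle : (R ∩ f '' (P ×ˢ Icc k (2 * m + 1))).ncard ≤ k := by
      refine (Set.ncard_le_ncard hsub (Finset.finite_toSet _)).trans ?_
      rw [Set.ncard_coe_finset]
      refine Finset.card_image_le.trans ?_
      rw [Nat.card_Ico]
      omega
    have : ((R ∩ f '' (P ×ˢ Icc k (2 * m + 1))).ncard : ℝ) ≤ k := by exact_mod_cast hle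
    linarith
  · intro R hR hv
    rw [e1] at hv
    obtain ⟨a, haN, S, hS, hx, hScard⟩ := exists_shape_cover hR hv
    let T : Set ((ℝ × ℝ) × ℕ) := {t ∈ P ×ˢ Icc k (2 * m + 1) | f t ∈ R}
    have hTfin : T.Finite := (hfin.prod (finite_Icc k (2 * m + 1))).subset (sep_subset _ _)
    have hsub : R ∩ f '' (P ×ˢ Icc k (2 * m + 1)) ⊆ f '' T := by
      rintro _ ⟨hzR, t, ht, rfl⟩
      exact ⟨t, ⟨ht, hzR⟩, rfl⟩
    -- The index and the cell of the cover determine the center, so pairs (index, cell) bound the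
    -- count.
    have hT : T.ncard ≤ ((Finset.Icc k (2 * m + 1) ×ˢ S : Finset (ℕ × ℤ)) : Set (ℕ × ℤ)).ncard := by
      refine Set.ncard_le_ncard_of_injOn (fun t => (t.2, ⌊(f t).2 * 2 ^ (2 * m + 1 - a)⌋)) ?_ ?_
        (Finset.finite_toSet _)
      · rintro t ⟨ht, htR⟩
        rw [Finset.mem_coe, Finset.mem_product]
        exact ⟨Finset.mem_Icc.2 ht.2, hS _ htR (hf t ht).mem⟩
      · rintro ⟨p, i⟩ ⟨ht, htR⟩ ⟨p', i'⟩ ⟨ht', htR'⟩ he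
        obtain ⟨rfl, he2⟩ := Prod.ext_iff.1 he
        have : p = p' := IsSatellite.center_unique hP ht.2.1 ht.2.2 ht.1 ht'.1 (hf _ ht) (hf _ ht')
          haN ⟨hx _ htR _ htR' (hf _ ht).mem (hf _ ht').mem, he2⟩
        rw [this]
    rw [Set.ncard_coe_finset, Finset.card_product, Nat.card_Icc] at hT
    have hle : (R ∩ f '' (P ×ˢ Icc k (2 * m + 1))).ncard ≤ (2 * m + 1 + 1 - k) * S.card :=
      ((Set.ncard_le_ncard hsub (hTfin.image f)).trans (Set.ncard_image_le hTfin)).trans hT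
    have hle' : ((R ∩ f '' (P ×ˢ Icc k (2 * m + 1))).ncard : ℝ) ≤ (2 * m + 1) * S.card := by
      refine le_trans (Nat.cast_le.2 (hle.trans (Nat.mul_le_mul_right _
        (show 2 * m + 1 + 1 - k ≤ 2 * m + 1 by omega)))) ?_
      push_cast
      exact le_rfl
    have hV : (0 : ℝ) ≤ 2 ^ (2 * m) * volume.real R := by positivity
    calc ((R ∩ f '' (P ×ˢ Icc k (2 * m + 1))).ncard : ℝ) ≤ (2 * m + 1) * S.card := hle'
      _ ≤ (2 * m + 1) * (2 ^ (2 * m + 1) * volume.real R) := by gcongr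
      _ = (2 * (2 * m + 1)) * (2 ^ (2 * m) * volume.real R) := by ring
      _ ≤ (8 * (m * k)) * (2 ^ (2 * m) * volume.real R) := by
        refine mul_le_mul_of_nonneg_right ?_ hV
        nlinarith
      _ = 8 * ((2 : ℝ) ^ (2 * m) * (m : ℝ) * (k : ℝ) * volume.real R) := by ring
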